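/- Let $X$ be an uncountable Polish space and let $Y \subseteq X$ be a complete analytic set or a complete coanalytic set. Then $Y$ cannot be written as a union of fewer than $\mathrm{cov}(\text{meager})$ Borel sets whose Borel ranks are bounded below $\omega_1$; that is, there is no family $\mathcal F$ of Borel subsets of $X$ with $|\mathcal F| < \mathrm{cov}(\text{meager})$ and $\bigcup \mathcal F = Y$ for which some ordinal $\alpha < \omega_1$ satisfies $\mathrm{rank}(B) \le \alpha$ for all $B \in \mathcal F$. Here $\mathrm{cov}(\text{meager})$ is the least cardinal $\kappa$ such that the Baire space $\omega^\omega$ is a union of $\kappa$ meager sets. The Borel rank of a Borel set $B$ is the least $\alpha \ge 1$ such that $B$ belongs to $\boldsymbol\Sigma^0_\alpha \cup \boldsymbol\Pi^0_\alpha$, where $\boldsymbol\Sigma^0_1$ consists of the open sets, $\boldsymbol\Pi^0_\alpha$ of the complements of $\boldsymbol\Sigma^0_\alpha$ sets, and, for $\alpha > 1$, $\boldsymbol\Sigma^0_\alpha$ of the countable unions of sets from $\bigcup_{1 \le \beta < \alpha} \boldsymbol\Pi^0_\beta$. A set $Y \subseteq X$ is complete analytic (respectively, complete coanalytic) if it is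 analytic (coanalytic) and for every analytic (coanalytic) set $A \subseteq \omega^\omega$ there is a Borel map $f : \omega^\omega \to X$ with $f^{-1}(Y) = A$. -/

import Mathlib

open Set MeasureTheory
open scoped Cardinal Ordinal

/-- `cov(meager)`: the least cardinal `κ` such that the Baire space `ℕ → ℕ` is the union of `κ`
meager sets. -/
noncomputable def covMeager : Cardinal.{0} :=
  sInf {κ | ∃ F : Set (Set (ℕ → ℕ)), #F = κ ∧ (∀ M ∈ F, IsMeagre M) ∧ ⋃₀ F = univ}

/-- The additive Borel classes: `IsSigma0 1 s` says that `s` is open, and for `α > 1`,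
`IsSigma0 α s` says that `s = ⋃ n, f n` where each `f n` is the complement of a set of some
additive class `β n` with `1 ≤ β n < α`. (No set satisfies `IsSigma0 0`.) -/
inductive IsSigma0 {X : Type*} [TopologicalSpace X] : Ordinal.{0} → Set X → Prop
  | isOpen (s : Set X) (hs : IsOpen s) : IsSigma0 1 s
  | iUnion (α : Ordinal.{0}) (β : ℕ → Ordinal.{0}) (f : ℕ → Set X)
      (hβ : ∀ n, 1 ≤ β n ∧ β n < α) (hf : ∀ n, IsSigma0 (β n) (f n)ᶜ) :
      IsSigma0 α (⋃ n, f n)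

/-- The multiplicative Borel classes: complements of sets of the additive classes. -/
def IsPi0 {X : Type*} [TopologicalSpace X] (α : Ordinal.{0}) (s : Set X) : Prop :=
  IsSigma0 α sᶜ

/-- The Borel rank of a Borel set: the least `α` such that the set is in the additive or in the
multiplicative class `α`. -/
noncomputable def borelRank {X : Type*} [TopologicalSpace X] (s : Set X) : Ordinal.{0} :=
  sInf {α | IsSigma0 α s ∨ IsPi0 α s}

/-- `A` is the preimage of `Y` under a Borel measurable map. -/
def BorelReducible {Z X : Type*} [TopologicalSpace Z] [TopologicalSpace X]
    (A : Set Z) (Y : Set X) : Prop :=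
  ∃ f : Z → X, Measurable[borel Z, borel X] f ∧ f ⁻¹' Y = A

/-- A coanalytic set: the complement of an analytic set. -/
def CoanalyticSet {X : Type*} [TopologicalSpace X] (s : Set X) : Prop :=
  AnalyticSet sᶜ

/-- A complete analytic set: an analytic set to which every analytic subset of the Baire space
is Borel reducible. -/
def IsCompleteAnalytic {X : Type*} [TopologicalSpace X] (Y : Set X) : Prop :=
  AnalyticSet Y ∧ ∀ A : Set (ℕ → ℕ), AnalyticSet A → BorelReducible A Y

/-- A complete coanalytic set: a coanalytic set to which every coanalytic subset of the Baire
space is Borel reducible. -/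
def IsCompleteCoanalytic {X : Type*} [TopologicalSpace X] (Y : Set X) : Prop :=
  CoanalyticSet Y ∧ ∀ A : Set (ℕ → ℕ), CoanalyticSet A → BorelReducible A Y

/-! This is Steel's tagged-tree forcing, phrased with Baire category. Let A be `infiniteBranchSet`
or its complement. By completeness one of the two is a Borel preimage of Y, and preimages keep ranks
bounded (`exists_isSigma0_preimage`), so it suffices to treat A.

Reading x through a decoder gives a forest with tagged nodes, and `parentMap` forgets the tags. If ⊤
is available as a tag, a generic forest has an infinite branch; if all tags are ordinals, every
forest is well-founded. Yet a set of class at most δ cannot separate two decoders that both code all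
tags below ω·(δ+1): comeagreness in a cylinder survives retagging (`IsSigma0.isMeagre_of_retag`).

Given fewer than cov(meager) sets with union A, take the decoder that is generically in A. Some
member B has nonmeagre preimage, hence is comeagre in a cylinder. Retagged to the other decoder, B
becomes comeagre in a cylinder where generic forests lie outside A, contradicting B ⊆ A. -/

/-! ### Borel classes and Borel preimages -/

theorem IsSigma0.one_le {X : Type*} [TopologicalSpace X] {α : Ordinal.{0}} {s : Set X}
    (h : IsSigma0 α s) : 1 ≤ α := by
  cases h with
  | isOpen _ _ => exact le_rfl
  | iUnion _ β f hβ hf => exact (hβ 0).1.trans (hβ 0).2.le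

theorem IsSigma0.compl_of_lt {X : Type*} [TopologicalSpace X] {α β : Ordinal.{0}} {s : Set X}
    (h : IsSigma0 α s) (hαβ : α < β) : IsSigma0 β sᶜ := by
  rw [← iUnion_const (ι := ℕ) sᶜ]
  exact .iUnion β (fun _ => α) _ (fun _ => ⟨h.one_le, hαβ⟩) fun _ => by rwa [compl_compl]

theorem IsSigma0.measurableSet {X : Type*} [TopologicalSpace X] {α : Ordinal.{0}} {s : Set X}
    (h : IsSigma0 α s) : MeasurableSet[borel X] s := by
  let _ : MeasurableSpace X := borel X
  have : BorelSpace X := ⟨rfl⟩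
  induction h with
  | isOpen s hs => exact hs.measurableSet
  | iUnion α β f hβ hf ih => exact .iUnion fun n => (ih n).of_compl

theorem add_one_lt_omega_one {α : Ordinal.{0}} (h : α < ω₁) : α + 1 < ω₁ :=
  Ordinal.isPrincipal_add_omega 1 h (Ordinal.one_lt_omega0.trans Ordinal.omega0_lt_omega_one)

/-- Every Borel set belongs to some additive class of countable index. -/
theorem exists_isSigma0_of_measurableSet {X : Type*} [TopologicalSpace X] {s : Set X}
    (hs : MeasurableSet[borel X] s) : ∃ α : Ordinal.{0}, α < ω₁ ∧ IsSigma0 α s := by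
  induction s, hs using MeasurableSpace.generateFrom_induction with
  | hC t ht _ => exact ⟨1, Ordinal.one_lt_omega0.trans Ordinal.omega0_lt_omega_one, .isOpen t ht⟩
  | empty =>
    exact ⟨1, Ordinal.one_lt_omega0.trans Ordinal.omega0_lt_omega_one, .isOpen _ isOpen_empty⟩
  | compl t _ ih =>
    obtain ⟨α, hα, h⟩ := ih
    exact ⟨α + 1, add_one_lt_omega_one hα, h.compl_of_lt (lt_add_one α)⟩
  | iUnion f _ ih =>
    choose α hα h using ih
    refine ⟨(⨆ n, (α n + 1)) + 1, add_one_lt_omega_one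
      (Ordinal.iSup_lt_omega_one fun n => add_one_lt_omega_one (hα n)),
      .iUnion _ (fun n => α n + 1) f (fun n => ⟨?_, ?_⟩)
        fun n => (h n).compl_of_lt (lt_add_one _)⟩
    · exact le_add_self
    · exact Order.lt_add_one_iff.2 (Ordinal.le_iSup (fun n => α n + 1) n)

/-- A Borel set of rank at most `α` has a complement of additive class at most `α + 1`. -/
theorem exists_isSigma0_compl_of_borelRank_le {X : Type*} [TopologicalSpace X] {s : Set X}
    {α : Ordinal.{0}} (hs : MeasurableSet[borel X] s) (h : borelRank s ≤ α) :
    ∃ γ ≤ α + 1, IsSigma0 γ sᶜ := by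
  obtain ⟨δ, -, hδ⟩ := exists_isSigma0_of_measurableSet hs
  have hmem : borelRank s ∈ {α | IsSigma0 α s ∨ IsPi0 α s} := csInf_mem ⟨δ, .inl hδ⟩
  rcases hmem with h1 | h1
  · exact ⟨α + 1, le_rfl, h1.compl_of_lt (Order.lt_add_one_iff.2 h)⟩
  · exact ⟨_, h.trans (lt_add_one α).le, h1⟩

/-- Preimages under a Borel map raise the additive class by a bounded amount. -/
theorem exists_isSigma0_preimage {Z X : Type*} [TopologicalSpace Z] [TopologicalSpace X]
    [SecondCountableTopology X] {f : Z → X} (hf : Measurable[borel Z, borel X] f) :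
    ∃ β : Ordinal.{0}, β < ω₁ ∧
      ∀ (γ : Ordinal.{0}) (s : Set X), IsSigma0 γ s → IsSigma0 (β + γ) (f ⁻¹' s) := by
  have hbasic : ∀ U : TopologicalSpace.countableBasis X,
      ∃ α : Ordinal.{0}, α < ω₁ ∧ IsSigma0 α (f ⁻¹' U.1)ᶜ := fun U =>
    exists_isSigma0_of_measurableSet <| MeasurableSet.compl <| hf <|
      MeasurableSpace.measurableSet_generateFrom (TopologicalSpace.isOpen_of_mem_countableBasis U.2)
  choose α hα h using hbasic
  refine ⟨⨆ U, α U, Ordinal.iSup_lt_omega_one hα, fun γ s hs => ?_⟩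
  induction hs with
  | isOpen s hs =>
    obtain ⟨S, hS, rfl⟩ :=
      (TopologicalSpace.isBasis_countableBasis X).open_eq_sUnion hs
    rcases S.eq_empty_or_nonempty with rfl | hne
    · have := (IsSigma0.isOpen (X := Z) univ isOpen_univ)
      -- The supremum vanishes only if the basis is empty; then class 1 is exactly what is required.
      rcases eq_or_ne (⨆ U, α U) 0 with h0 | h0
      · simpa [h0] using IsSigma0.isOpen (X := Z) ∅ isOpen_empty
      · simpa using this.compl_of_lt
          (show 1 < (⨆ U, α U) + 1 by simpa [Order.lt_add_one_iff, Order.one_le_iff_pos,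
            pos_iff_ne_zero] using h0)
    · obtain ⟨u, hu⟩ := ((TopologicalSpace.countable_countableBasis X).mono hS).exists_eq_range hne
      have hu' : ∀ n, u n ∈ TopologicalSpace.countableBasis X := fun n => hS (hu ▸ mem_range_self n)
      rw [hu, sUnion_range, preimage_iUnion]
      refine .iUnion _ (fun n => α ⟨u n, hu' n⟩) _ (fun n => ⟨(h ⟨u n, hu' n⟩).one_le, ?_⟩)
        fun n => h ⟨u n, hu' n⟩
      exact Order.lt_add_one_iff.2 (Ordinal.le_iSup α _)
  | iUnion γ δ g hδ hg ih =>
    rw [preimage_iUnion]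
    exact .iUnion _ (fun n => (⨆ U, α U) + δ n) _
      (fun n => ⟨(hδ n).1.trans le_add_self, by simpa using (hδ n).2⟩) fun n => by
        simpa using ih n

/-! ### Cylinders and Baire category -/

open PiNat in
theorem exists_cylinder_subset {U : Set (ℕ → ℕ)} (hU : IsOpen U) {x : ℕ → ℕ} (hx : x ∈ U) (n : ℕ) :
    ∃ m ≥ n, cylinder x m ⊆ U := by
  obtain ⟨_, ⟨y, k, rfl⟩, hxy, hsub⟩ :=
    (isTopologicalBasis_cylinders (E := fun _ => ℕ)).exists_subset_of_mem_open hx hU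
  refine ⟨max n k, le_max_left _ _, (cylinder_anti x (le_max_right n k)).trans ?_⟩
  rwa [mem_cylinder_iff_eq.1 hxy]

theorem dense_of_forall_cylinder {S : Set (ℕ → ℕ)}
    (h : ∀ (x : ℕ → ℕ) (n : ℕ), ∃ y ∈ PiNat.cylinder x n, y ∈ S) : Dense S := by
  refine dense_iff_inter_open.2 fun U hU ⟨x, hx⟩ => ?_
  obtain ⟨m, -, hm⟩ := exists_cylinder_subset hU hx 0
  obtain ⟨y, hy, hyS⟩ := h x m
  exact ⟨y, hm hy, hyS⟩

open PiNat in
theorem not_isMeagre_cylinder (x : ℕ → ℕ) (n : ℕ) : ¬ IsMeagre (cylinder x n) :=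
  not_isMeagre_of_isOpen (isOpen_cylinder (E := fun _ => ℕ) x n) ⟨x, self_mem_cylinder x n⟩

open PiNat in
/-- A set with the Baire property that is not meagre in a cylinder is comeagre in a smaller one. -/
theorem exists_cylinder_diff_isMeagre {S : Set (ℕ → ℕ)} (hS : BaireMeasurableSet S) {y : ℕ → ℕ}
    {n : ℕ} (h : ¬ IsMeagre (cylinder y n ∩ S)) :
    ∃ z ∈ cylinder y n, ∃ m ≥ n, IsMeagre (cylinder z m \ S) := by
  obtain ⟨U, hU, hSU⟩ := hS.residualEq_isOpen
  have hne : (cylinder y n ∩ U).Nonempty := by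
    by_contra hempty
    refine h ?_
    filter_upwards [hSU] with z hz hzS
    exact hempty ⟨z, hzS.1, hz.mp hzS.2⟩
  obtain ⟨z, hzy, hzU⟩ := hne
  obtain ⟨m, hm, hsub⟩ := exists_cylinder_subset hU hzU n
  refine ⟨z, hzy, m, hm, ?_⟩
  filter_upwards [hSU] with w hw hwS
  exact hwS.2 (hw.mpr (hsub hwS.1))

/-! ### Tagged forests -/

/-- The order on tags in which the top tag lies below itself. -/
def TagLT (a b : WithTop Ordinal.{0}) : Prop :=
  a < b ∨ a = ⊤ ∧ b = ⊤

open Classical in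
/-- Decode `x` by `d` into a sequence of nodes, each carrying a tag and a proposed parent. The value
at `i` is `j + 1` if `j < i` is the proposed parent of `i` and the tags decrease from `j` to `i`, and
`0` if the proposal is void. -/
noncomputable def parentMap (d : ℕ → WithTop Ordinal.{0} × ℕ) (x : ℕ → ℕ) (i : ℕ) : ℕ :=
  if (d (x i)).2 < i ∧ TagLT (d (x i)).1 (d (x (d (x i)).2)).1 then (d (x i)).2 + 1 else 0

theorem parentMap_eq_add_one_iff {d : ℕ → WithTop Ordinal.{0} × ℕ} {x : ℕ → ℕ} {i j : ℕ} :
    parentMap d x i = j + 1 ↔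
      (d (x i)).2 = j ∧ j < i ∧ TagLT (d (x i)).1 (d (x j)).1 := by
  unfold parentMap
  split_ifs with h
  · constructor
    · intro h'
      obtain rfl : (d (x i)).2 = j := Nat.succ_injective h'
      exact ⟨rfl, h⟩
    · rintro ⟨rfl, -⟩
      rfl
  · refine ⟨fun h' => h'.elim, ?_⟩
    rintro ⟨rfl, h'⟩
    exact absurd h' h

theorem parentMap_congr {d : ℕ → WithTop Ordinal.{0} × ℕ} {x y : ℕ → ℕ} {i : ℕ}
    (h : ∀ j ≤ i, x j = y j) : parentMap d x i = parentMap d y i := by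
  unfold parentMap
  rw [h i le_rfl]
  by_cases hlt : (d (y i)).2 < i
  · rw [h _ hlt.le]
  · simp [hlt]

theorem continuous_parentMap (d : ℕ → WithTop Ordinal.{0} × ℕ) : Continuous (parentMap d) := by
  refine continuous_pi fun i => IsLocallyConstant.continuous ?_
  refine (IsLocallyConstant.iff_eventually_eq _).2 fun x => ?_
  filter_upwards [(PiNat.isOpen_cylinder (E := fun _ => ℕ) x (i + 1)).mem_nhds
    (PiNat.self_mem_cylinder x _)] with y hy
  exact parentMap_congr fun j hj => hy j (by omega)

/-! ### Retagging -/

/-- The first `n` nodes given by `x` and `y` have the same parents, and the same tags as far as tags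
below `ω * β` are concerned. -/
def Retag (β : Ordinal.{0}) (d e : ℕ → WithTop Ordinal.{0} × ℕ) (n : ℕ) (x y : ℕ → ℕ) : Prop :=
  ∀ i < n, parentMap d x i = parentMap e y i ∧
    ((d (x i)).1 = (e (y i)).1 ∨
      ((Ordinal.omega0 * β : Ordinal.{0}) : WithTop Ordinal.{0}) ≤ (d (x i)).1 ∧
        ((Ordinal.omega0 * β : Ordinal.{0}) : WithTop Ordinal.{0}) ≤ (e (y i)).1)

theorem Retag.symm {β : Ordinal.{0}} {d e : ℕ → WithTop Ordinal.{0} × ℕ} {n : ℕ} {x y : ℕ → ℕ}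
    (h : Retag β d e n x y) : Retag β e d n y x := fun i hi =>
  ⟨(h i hi).1.symm, (h i hi).2.imp Eq.symm And.symm⟩

theorem retag_zero (β : Ordinal.{0}) (d e : ℕ → WithTop Ordinal.{0} × ℕ) (x y : ℕ → ℕ) :
    Retag β d e 0 x y := fun _ hi => absurd hi (Nat.not_lt_zero _)

/-- The decoder `d` represents every node whose tag lies below `o`. -/
def CodesBelow (o : Ordinal.{0}) (d : ℕ → WithTop Ordinal.{0} × ℕ) : Prop :=
  ∀ a < o, ∀ k, ∃ m, d m = ((a : WithTop Ordinal.{0}), k)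

theorem exists_bound_of_lt {a b : Ordinal.{0}} (hab : a < b) (t : ℕ → WithTop Ordinal.{0}) (m : ℕ) :
    ∃ s, a ≤ s ∧ s < b ∧ ∀ i < m, t i < b → t i ≤ s := by
  induction m with
  | zero => exact ⟨a, le_rfl, hab, fun i hi => absurd hi (Nat.not_lt_zero _)⟩
  | succ m ih =>
    obtain ⟨s, has, hsb, hs⟩ := ih
    by_cases htm : t m < b
    · obtain ⟨c, hc⟩ := WithTop.ne_top_iff_exists.1 htm.ne_top
      rw [← hc, WithTop.coe_lt_coe] at htm
      refine ⟨max s c, has.trans (le_max_left _ _), max_lt hsb htm, fun i hi hib => ?_⟩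
      rcases Nat.lt_succ_iff_lt_or_eq.1 hi with h | rfl
      · exact (hs i h hib).trans (WithTop.coe_le_coe.2 (le_max_left _ _))
      · rw [← hc]
        exact WithTop.coe_le_coe.2 (le_max_right _ _)
    · refine ⟨s, has, hsb, fun i hi hib => ?_⟩
      rcases Nat.lt_succ_iff_lt_or_eq.1 hi with h | rfl
      · exact hs i h hib
      · exact absurd hib htm

theorem add_natCast_lt_omega0_mul {s β : Ordinal.{0}} (h : s < Ordinal.omega0 * β) (k : ℕ) :
    s + k < Ordinal.omega0 * β := by
  have hlim : Order.IsSuccLimit (Ordinal.omega0 * β) :=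
    Ordinal.isSuccLimit_mul_left Ordinal.isSuccLimit_omega0
      (pos_iff_ne_zero.2 (by rintro rfl; simp at h))
  induction k with
  | zero => simpa using h
  | succ k ih => simpa [← add_assoc] using hlim.add_one_lt ih

-- Tags below ω·β are copied; all others are replaced by fresh ones between ω·γ and ω·β. The factor
-- ω leaves room there for any finite descending chain.
open PiNat in
theorem Retag.exists_extension {γ β o : Ordinal.{0}} {d e : ℕ → WithTop Ordinal.{0} × ℕ}
    {n m : ℕ} {x y x' : ℕ → ℕ} (h : Retag β d e n x y) (he : CodesBelow o e) (hγβ : γ < β)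
    (hβo : Ordinal.omega0 * β ≤ o) (hx' : x' ∈ cylinder x n) :
    ∃ y' ∈ cylinder y n, Retag γ d e m x' y' := by
  have hlt : Ordinal.omega0 * γ < Ordinal.omega0 * β :=
    mul_lt_mul_of_pos_left hγβ Ordinal.omega0_pos
  -- The fresh tags s + (m - i) exceed every copied tag at places below m, decrease in i, and stay
  -- below the limit ω·β.
  obtain ⟨s, hγs, hsβ, hs⟩ := exists_bound_of_lt hlt (fun i => (d (x' i)).1) m
  set θ : WithTop Ordinal.{0} := ((Ordinal.omega0 * β : Ordinal.{0}) : WithTop Ordinal.{0}) with hθ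
  -- A void proposal is coded by naming i as its own parent.
  have hex : ∀ i, ∃ k, (i < n → k = y i) ∧ (n ≤ i →
      (e k).2 = (if parentMap d x' i = 0 then i else parentMap d x' i - 1) ∧
      ((d (x' i)).1 < θ → (e k).1 = (d (x' i)).1) ∧
      (¬ (d (x' i)).1 < θ → (e k).1 = ((s + (m - i : ℕ) : Ordinal.{0}) : WithTop Ordinal.{0}))) := by
    intro i
    by_cases hi : i < n
    · exact ⟨y i, fun _ => rfl, fun h => absurd hi h.not_gt⟩
    by_cases ht : (d (x' i)).1 < θ
    · obtain ⟨c, hc⟩ := WithTop.ne_top_iff_exists.1 ht.ne_top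
      obtain ⟨k, hk⟩ := he c ((WithTop.coe_lt_coe.1 (hc ▸ ht)).trans_le hβo)
        (if parentMap d x' i = 0 then i else parentMap d x' i - 1)
      exact ⟨k, fun h => absurd h hi, fun _ => by simp [hk, hc, ht]⟩
    · obtain ⟨k, hk⟩ := he (s + (m - i : ℕ)) ((add_natCast_lt_omega0_mul hsβ _).trans_le hβo)
        (if parentMap d x' i = 0 then i else parentMap d x' i - 1)
      exact ⟨k, fun h => absurd h hi, fun _ => by simp [hk, ht]⟩
  choose y' hold hnew using hex
  have hsame : ∀ i, (d (x' i)).1 < θ → (e (y' i)).1 = (d (x' i)).1 := by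
    intro i hi
    rcases lt_or_ge i n with hin | hin
    · rw [hold i hin]
      rw [hx' i hin] at hi ⊢
      rcases (h i hin).2 with h2 | h2
      · exact h2.symm
      · exact absurd hi h2.1.not_gt
    · exact (hnew i hin).2.1 hi
  have hbig : ∀ i < n, ¬ (d (x' i)).1 < θ → θ ≤ (e (y' i)).1 := by
    intro i hin hi
    rw [hold i hin]
    rw [hx' i hin] at hi
    rcases (h i hin).2 with h2 | h2
    · exact h2 ▸ not_lt.1 hi
    · exact h2.2
  have hcoe : ∀ k : ℕ, ((s + k : Ordinal.{0}) : WithTop Ordinal.{0}) < θ := fun k =>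
    WithTop.coe_lt_coe.2 (add_natCast_lt_omega0_mul hsβ k)
  have hTag : ∀ i j, n ≤ i → j < i → i < m → TagLT (d (x' i)).1 (d (x' j)).1 →
      TagLT (e (y' i)).1 (e (y' j)).1 := by
    intro i j hni hji him hT
    by_cases hi : (d (x' i)).1 < θ
    · rw [hsame i hi]
      by_cases hj : (d (x' j)).1 < θ
      · rwa [hsame j hj]
      · left
        rcases lt_or_ge j n with hjn | hjn
        · exact hi.trans_le (hbig j hjn hj)
        · rw [(hnew j hjn).2.2 hj]
          refine (hs i him hi).trans_lt (WithTop.coe_lt_coe.2 ?_)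
          exact lt_add_of_pos_right s (by exact_mod_cast (show 0 < m - j by omega))
    · have hj : ¬ (d (x' j)).1 < θ := fun hj => hi <| by
        rcases hT with h1 | h1
        · exact h1.trans hj
        · rw [h1.2] at hj
          exact absurd hj not_top_lt
      left
      rw [(hnew i hni).2.2 hi]
      rcases lt_or_ge j n with hjn | hjn
      · exact (hcoe _).trans_le (hbig j hjn hj)
      · rw [(hnew j hjn).2.2 hj]
        refine WithTop.coe_lt_coe.2 ((add_lt_add_iff_left s).2 ?_)
        exact_mod_cast (show m - i < m - j by omega)
  refine ⟨y', hold, fun i him => ⟨?_, ?_⟩⟩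
  · rcases lt_or_ge i n with hin | hin
    · rw [parentMap_congr (x := x') (y := x) fun j hj => hx' j (by omega),
        parentMap_congr (x := y') (y := y) fun j hj => hold j (by omega)]
      exact (h i hin).1
    · have h2 := (hnew i hin).1
      rcases hP : parentMap d x' i with _ | j
      · rw [hP, if_pos rfl] at h2
        simp [parentMap, h2]
      · rw [hP, if_neg (Nat.succ_ne_zero j), Nat.add_sub_cancel] at h2
        obtain ⟨-, hji, hT⟩ := parentMap_eq_add_one_iff.1 hP
        exact (parentMap_eq_add_one_iff.2 ⟨h2, hji, hTag i j hin hji him hT⟩).symm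
  · by_cases hi : (d (x' i)).1 < θ
    · exact .inl (hsame i hi).symm
    · right
      have hγθ : ((Ordinal.omega0 * γ : Ordinal.{0}) : WithTop Ordinal.{0}) ≤ θ :=
        WithTop.coe_le_coe.2 hlt.le
      refine ⟨hγθ.trans (not_lt.1 hi), ?_⟩
      rcases lt_or_ge i n with hin | hin
      · exact hγθ.trans (hbig i hin hi)
      · rw [(hnew i hin).2.2 hi]
        exact WithTop.coe_le_coe.2 (hγs.trans le_self_add)

theorem baireMeasurableSet_preimage_parentMap (d : ℕ → WithTop Ordinal.{0} × ℕ)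
    {s : Set (ℕ → ℕ)} (hs : MeasurableSet[borel (ℕ → ℕ)] s) :
    BaireMeasurableSet (parentMap d ⁻¹' s) := by
  rw [← BorelSpace.measurable_eq (α := ℕ → ℕ)] at hs
  exact ((continuous_parentMap d).measurable hs).baireMeasurableSet

open PiNat in
/-- Retagging preserves comeagreness of the preimage of a multiplicative set. -/
theorem IsSigma0.isMeagre_of_retag {o β : Ordinal.{0}} {s : Set (ℕ → ℕ)} (hs : IsSigma0 β s)
    {d e : ℕ → WithTop Ordinal.{0} × ℕ} (hd : CodesBelow o d) (he : CodesBelow o e)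
    (hβ : Ordinal.omega0 * β ≤ o) {n : ℕ} {x y : ℕ → ℕ} (h : Retag β d e n x y)
    (hm : IsMeagre (cylinder x n ∩ parentMap d ⁻¹' s)) :
    IsMeagre (cylinder y n ∩ parentMap e ⁻¹' s) := by
  induction hs generalizing d e n x y with
  | isOpen s hs =>
    suffices hempty : cylinder y n ∩ parentMap e ⁻¹' s = ∅ by
      rw [hempty]
      exact IsMeagre.empty
    refine eq_empty_of_forall_notMem fun z hz => ?_
    obtain ⟨m, hmn, hsub⟩ := exists_cylinder_subset hs hz.2 n
    -- For open sets agreement of parents suffices, so level 0 is enough.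
    obtain ⟨x', hx', hR⟩ := h.symm.exists_extension (m := m) hd zero_lt_one hβ hz.1
    refine not_isMeagre_cylinder x' m (hm.mono fun w hw => ?_)
    refine ⟨?_, hsub fun i hi => ?_⟩
    · rw [← mem_cylinder_iff_eq.1 hx']
      exact cylinder_anti x' hmn hw
    · rw [(hR i hi).1]
      exact parentMap_congr fun j hj => hw j (by omega)
  | iUnion β δ f hδ hf ih =>
    by_contra hcon
    obtain ⟨k, hk⟩ : ∃ k, ¬ IsMeagre (cylinder y n ∩ parentMap e ⁻¹' f k) := by
      by_contra! hall
      refine hcon ?_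
      rw [preimage_iUnion, inter_iUnion]
      exact isMeagre_iUnion hall
    obtain ⟨y', hy', m, hmn, hy'm⟩ := exists_cylinder_diff_isMeagre
      (baireMeasurableSet_preimage_parentMap e (hf k).measurableSet.of_compl) hk
    obtain ⟨x', hx', hR⟩ := h.symm.exists_extension (m := m) hd (hδ k).2 hβ hy'
    -- The decoders swap roles and the level drops to δ k.
    have hx'm := ih k he hd ((mul_le_mul_right (hδ k).2.le _).trans hβ) hR hy'm
    refine not_isMeagre_cylinder x' m ((hx'm.union hm).mono fun w hw => ?_)
    by_cases hwf : parentMap d w ∈ f k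
    · refine .inr ⟨?_, mem_iUnion.2 ⟨k, hwf⟩⟩
      rw [← mem_cylinder_iff_eq.1 hx']
      exact cylinder_anti x' hmn hw
    · exact .inl ⟨hw, hwf⟩

/-! ### Infinite branches -/

/-- The parent functions of forests on `ℕ` with an infinite branch. -/
def infiniteBranchSet : Set (ℕ → ℕ) :=
  {P | ∃ b : ℕ → ℕ, ∀ k, P (b (k + 1)) = b k + 1}

theorem analyticSet_infiniteBranchSet : AnalyticSet infiniteBranchSet := by
  have hclosed : IsClosed {q : (ℕ → ℕ) × (ℕ → ℕ) | ∀ k, q.1 (q.2 (k + 1)) = q.2 k + 1} := by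
    have heq : {q : (ℕ → ℕ) × (ℕ → ℕ) | ∀ k, q.1 (q.2 (k + 1)) = q.2 k + 1} =
        ⋂ (k : ℕ) (i : ℕ), {q | q.2 (k + 1) = i → q.1 i = q.2 k + 1} := by
      ext q
      simp
    rw [heq]
    refine isClosed_iInter fun k => isClosed_iInter fun i => isClosed_imp ?_ ?_
    · exact (isOpen_discrete {i}).preimage (by fun_prop)
    · exact isClosed_eq (by fun_prop) (by fun_prop)
  have himage : infiniteBranchSet =
      Prod.fst '' {q : (ℕ → ℕ) × (ℕ → ℕ) | ∀ k, q.1 (q.2 (k + 1)) = q.2 k + 1} := by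
    ext P
    simp [infiniteBranchSet]
  rw [himage]
  exact hclosed.analyticSet.image_of_continuous continuous_fst

/-- Without ⊤, tags strictly decrease along a branch. -/
theorem parentMap_notMem_infiniteBranchSet {d : ℕ → WithTop Ordinal.{0} × ℕ}
    (hd : ∀ m, (d m).1 ≠ ⊤) (x : ℕ → ℕ) : parentMap d x ∉ infiniteBranchSet := by
  rintro ⟨b, hb⟩
  refine not_strictAnti_of_wellFoundedLT (fun k => (d (x (b k))).1) (strictAnti_nat_of_succ_lt ?_)
  intro k
  rcases (parentMap_eq_add_one_iff.1 (hb k)).2.2 with h | h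
  · exact h
  · exact absurd h.1 (hd _)

/-- Generically every symbol recurs forever, so each i is proposed as parent by a later node tagged
⊤. -/
theorem isMeagre_preimage_compl_infiniteBranchSet {d : ℕ → WithTop Ordinal.{0} × ℕ}
    (hd : ∀ k, ∃ m, d m = (⊤, k)) : IsMeagre (parentMap d ⁻¹' infiniteBranchSetᶜ) := by
  choose c hc using hd
  have hdense : ∀ i N : ℕ, ∀ᶠ x in residual (ℕ → ℕ), ∃ j > N, x j = c i := by
    intro i N
    refine residual_of_dense_open ?_ (dense_of_forall_cylinder fun x n => ?_)
    · have heq : {x : ℕ → ℕ | ∃ j > N, x j = c i} =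
          ⋃ (j : ℕ) (_ : j > N), (fun x : ℕ → ℕ => x j) ⁻¹' {c i} := by
        ext x
        simp
      rw [heq]
      exact isOpen_iUnion fun j => isOpen_iUnion fun _ =>
        (isOpen_discrete _).preimage (continuous_apply j)
    · refine ⟨Function.update x (max n (N + 1)) (c i), fun k hk => ?_, max n (N + 1), ?_, by simp⟩
      · exact Function.update_of_ne (by omega) _ _
      · omega
  have hall : ∀ᶠ x in residual (ℕ → ℕ), ∀ i N : ℕ, ∃ j > N, x j = c i :=
    eventually_countable_forall.2 fun i => eventually_countable_forall.2 (hdense i)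
  filter_upwards [hall] with x hx hxP
  refine hxP ?_
  choose next hnext_gt hnext using fun i => hx i i
  -- Starting at `next 0` ensures that the first node is already tagged ⊤.
  refine ⟨fun k => next^[k] (next 0), fun k => ?_⟩
  have htop : ∀ k, (d (x (next^[k] (next 0)))).1 = ⊤ := by
    intro k
    rw [← Function.iterate_succ_apply, Function.iterate_succ_apply', hnext, hc]
  refine parentMap_eq_add_one_iff.2 ⟨?_, ?_, .inr ⟨htop _, htop _⟩⟩
  · beta_reduce
    rw [Function.iterate_succ_apply', hnext, hc]
  · beta_reduce
    rw [Function.iterate_succ_apply']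
    exact hnext_gt _

theorem countable_Iio_of_lt_omega_one {o : Ordinal.{0}} (ho : o < ω₁) : (Iio o).Countable := by
  rw [← Cardinal.le_aleph0_iff_set_countable, Cardinal.mk_Iio_ordinal, ← Cardinal.lift_aleph0.{1, 0},
    Cardinal.lift_le, ← Cardinal.lt_aleph_one_iff]
  exact Cardinal.lt_omega_iff_card_lt.1 ho

theorem exists_codesBelow_ne_top {o : Ordinal.{0}} (h0 : 0 < o) (ho : o < ω₁) :
    ∃ d : ℕ → WithTop Ordinal.{0} × ℕ, CodesBelow o d ∧ ∀ m, (d m).1 ≠ ⊤ := by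
  obtain ⟨u, hu⟩ := ((countable_Iio_of_lt_omega_one ho).prod (countable_univ (α := ℕ))).exists_eq_range
    ⟨(0, 0), h0, mem_univ _⟩
  refine ⟨fun m => ((u m).1, (u m).2), fun a ha k => ?_, fun m => WithTop.coe_ne_top⟩
  obtain ⟨m, hm⟩ := hu.subset (show (a, k) ∈ Iio o ×ˢ univ from ⟨ha, mem_univ _⟩)
  exact ⟨m, by simp [hm]⟩

theorem exists_codesBelow_top {o : Ordinal.{0}} (ho : o < ω₁) :
    ∃ d : ℕ → WithTop Ordinal.{0} × ℕ, CodesBelow o d ∧ ∀ k, ∃ m, d m = (⊤, k) := by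
  obtain ⟨u, hu⟩ := ((((countable_Iio_of_lt_omega_one ho).image
    ((↑) : Ordinal.{0} → WithTop Ordinal.{0})).insert ⊤).prod
      (countable_univ (α := ℕ))).exists_eq_range ⟨(⊤, 0), mem_insert _ _, mem_univ _⟩
  refine ⟨u, fun a ha k => ?_, fun k => ?_⟩
  · exact hu.subset ⟨.inr ⟨a, ha, rfl⟩, mem_univ _⟩
  · exact hu.subset ⟨.inl rfl, mem_univ _⟩

/-! ### Covering argument -/

/-- If one decoder maps into `A` and another one maps generically into the complement of `A`, then
`A` is not a union of fewer than `cov(meager)` sets of bounded multiplicative class. -/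
theorem sUnion_ne_of_codesBelow {A : Set (ℕ → ℕ)} {δ : Ordinal.{0}}
    {d e : ℕ → WithTop Ordinal.{0} × ℕ} (hd : CodesBelow (Ordinal.omega0 * (δ + 1)) d)
    (he : CodesBelow (Ordinal.omega0 * (δ + 1)) e)
    (hdA : IsMeagre (parentMap d ⁻¹' Aᶜ)) (heA : IsMeagre (parentMap e ⁻¹' A))
    {F : Set (Set (ℕ → ℕ))} (hF : #F < covMeager) (hrank : ∀ B ∈ F, ∃ γ ≤ δ, IsSigma0 γ Bᶜ) :
    ⋃₀ F ≠ A := by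
  rintro rfl
  obtain ⟨B, hBF, hB⟩ : ∃ B ∈ F, ¬ IsMeagre (parentMap d ⁻¹' B) := by
    by_contra! hall
    rcases F.eq_empty_or_nonempty with rfl | ⟨B₀, hB₀⟩
    · refine not_isMeagre_of_isOpen isOpen_univ (univ_nonempty (α := ℕ → ℕ)) ?_
      simpa using hdA
    -- Joining the meagre remainder to each preimage covers the space without adding to the number
    -- of sets.
    refine notMem_of_lt_csInf' (Cardinal.mk_image_le.trans_lt hF)
      ⟨(fun B => parentMap d ⁻¹' B ∪ parentMap d ⁻¹' (⋃₀ F)ᶜ) '' F, rfl, ?_, ?_⟩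
    · rintro _ ⟨B, hB, rfl⟩
      exact (hall B hB).union hdA
    · refine eq_univ_of_forall fun x => ?_
      by_cases hx : parentMap d x ∈ ⋃₀ F
      · obtain ⟨B, hB, hxB⟩ := hx
        exact ⟨_, mem_image_of_mem _ hB, .inl hxB⟩
      · exact ⟨_, mem_image_of_mem _ hB₀, .inr hx⟩
  obtain ⟨γ, hγ, hBγ⟩ := hrank B hBF
  obtain ⟨x, -, n, -, hx⟩ := exists_cylinder_diff_isMeagre (y := 0) (n := 0)
    (baireMeasurableSet_preimage_parentMap d hBγ.measurableSet.of_compl)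
    (by rwa [PiNat.cylinder_zero, univ_inter])
  have hγδ : γ < δ + 1 := Order.lt_add_one_iff.2 hγ
  -- The empty conditions agree at level δ + 1, leaving one level to spend on reaching a match for
  -- the cylinder of x.
  obtain ⟨y, -, hR⟩ := (retag_zero (δ + 1) d e x x).exists_extension (m := n) he hγδ le_rfl
    (PiNat.self_mem_cylinder x 0)
  have hy := hBγ.isMeagre_of_retag hd he (mul_le_mul_right hγδ.le _) hR hx
  refine not_isMeagre_cylinder y n ((hy.union heA).mono fun w hw => ?_)
  by_cases hwB : parentMap e w ∈ B
  · exact .inr ⟨B, hBF, hwB⟩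
  · exact .inl ⟨hw, hwB⟩

/-- Neither the set of functions with an infinite branch nor its complement is a union of fewer than
`cov(meager)` sets of bounded multiplicative class. -/
theorem sUnion_ne_infiniteBranchSet {δ : Ordinal.{0}} (hδ : δ < ω₁)
    {F : Set (Set (ℕ → ℕ))} (hF : #F < covMeager) (hrank : ∀ B ∈ F, ∃ γ ≤ δ, IsSigma0 γ Bᶜ) :
    ⋃₀ F ≠ infiniteBranchSet ∧ ⋃₀ F ≠ infiniteBranchSetᶜ := by
  have ho : Ordinal.omega0 * (δ + 1) < ω₁ := Ordinal.isPrincipal_mul_omega 1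
    Ordinal.omega0_lt_omega_one (add_one_lt_omega_one hδ)
  obtain ⟨d, hd, hd_top⟩ := exists_codesBelow_top ho
  obtain ⟨e, he, he_ne⟩ := exists_codesBelow_ne_top
    (mul_pos Ordinal.omega0_pos (Order.lt_add_one_iff.2 zero_le)) ho
  have hdA := isMeagre_preimage_compl_infiniteBranchSet hd_top
  have heA : IsMeagre (parentMap e ⁻¹' infiniteBranchSet) := by
    rw [eq_empty_of_forall_notMem (s := parentMap e ⁻¹' infiniteBranchSet)
      (parentMap_notMem_infiniteBranchSet he_ne)]
    exact IsMeagre.empty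
  exact ⟨sUnion_ne_of_codesBelow hd he hdA heA hF hrank,
    sUnion_ne_of_codesBelow he hd (by rwa [compl_compl]) hdA hF hrank⟩

theorem corollary3 {X : Type*} [TopologicalSpace X] [PolishSpace X] [Uncountable X]
    (Y : Set X) (hY : IsCompleteAnalytic Y ∨ IsCompleteCoanalytic Y) :
    ¬ ∃ F : Set (Set X),
        #F < Cardinal.lift covMeager ∧
        (∀ B ∈ F, MeasurableSet[borel X] B) ∧
        (∃ α : Ordinal.{0}, α < ω₁ ∧ ∀ B ∈ F, borelRank B ≤ α) ∧
        ⋃₀ F = Y := by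
  rintro ⟨F, hF, hFmeas, ⟨α, hα, hrank⟩, rfl⟩
  obtain ⟨A, hA, f, hf, hfA⟩ : ∃ A : Set (ℕ → ℕ),
      (A = infiniteBranchSet ∨ A = infiniteBranchSetᶜ) ∧ BorelReducible A (⋃₀ F) := by
    rcases hY with hY | hY
    · exact ⟨_, .inl rfl, hY.2 _ analyticSet_infiniteBranchSet⟩
    · refine ⟨_, .inr rfl, hY.2 _ ?_⟩
      rw [CoanalyticSet, compl_compl]
      exact analyticSet_infiniteBranchSet
  obtain ⟨β, hβ, hpre⟩ := exists_isSigma0_preimage hf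
  -- β pays for the preimage, the 1 for complementation.
  have hδ : β + (α + 1) < ω₁ := Ordinal.isPrincipal_add_omega 1 hβ (add_one_lt_omega_one hα)
  have hcard : #((f ⁻¹' ·) '' F : Set (Set (ℕ → ℕ))) < covMeager :=
    Cardinal.lift_lt.1 ((Cardinal.mk_image_le_lift.trans_eq (Cardinal.lift_uzero _)).trans_lt hF)
  have hbound : ∀ B ∈ (f ⁻¹' ·) '' F, ∃ γ ≤ β + (α + 1), IsSigma0 γ Bᶜ := by
    rintro _ ⟨B, hB, rfl⟩
    obtain ⟨γ, hγ, hBγ⟩ := exists_isSigma0_compl_of_borelRank_le (hFmeas B hB) (hrank B hB)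
    exact ⟨β + γ, by gcongr, hpre γ _ hBγ⟩
  have hU : ⋃₀ ((f ⁻¹' ·) '' F) = A := by
    rw [← hfA, sUnion_image, preimage_sUnion]
  obtain ⟨h1, h2⟩ := sUnion_ne_infiniteBranchSet hδ hcard hbound
  rcases hA with rfl | rfl
  · exact h1 hU
  · exact h2 hU
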